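/- Let $G$ be a finite group. A \emph{$G$-Tambara functor} $T$ consists of commutative rings $T(G/H)$ for all subgroups $H\le G$; for all $K\le H\le G$, a ring homomorphism $r^H_K\colon T(G/H)\to T(G/K)$ (restriction), an additive homomorphism $t^H_K\colon T(G/K)\to T(G/H)$ (transfer) and a homomorphism of multiplicative monoids $N^H_K\colon T(G/K)\to T(G/H)$ (norm); and, for all $g\in G$ and $H\le G$, a ring isomorphism $c_{g,H}\colon T(G/H)\to T(G/gHg^{-1})$ (conjugation), such that: (T1) restrictions, transfers, norms and conjugations are functorial: each of $r,t,N$ is transitive along $L\le K\le H$, $r^H_H=t^H_H=N^H_H=\mathrm{id}$, $c_{g,hHh^{-1}}c_{h,H}=c_{gh,H}$, and $c_{h,H}=\mathrm{id}$ for $h\in H$; (T2) conjugation commutes with restrictions, transfers and norms; (T3), (T4) for $H,L\le K$ and $a\in T(G/H)$, with $H_\gamma:=\gamma H\gamma^{-1}$, $$r^K_L t^K_H(a)=\sum_{[\gamma]\in L\backslash K/H}t^L_{L\cap H_\gamma}r^{H_\gamma}_{L\cap H_\gamma}c_{\gamma,H}(a),\qquad r^K_L N^K_H(a)=\prod_{[\gamma]\in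 L\backslash K/H}N^L_{L\cap H_\gamma}r^{H_\gamma}_{L\cap H_\gamma}c_{\gamma,H}(a);$$ (T5) $t^H_K(r^H_K(x)\,y)=x\,t^H_K(y)$ for $K\le H$, $x\in T(G/H)$, $y\in T(G/K)$; (T6) (Tambara reciprocity for sums and for transfers) for $H\le L$ and $a_0,a_1\in T(G/H)$, $$N^L_H(a_0+a_1)=\sum_{[f]}t^L_{L_f}\Bigl(\prod_{[\gamma]\in L_f\backslash L/H}N^{L_f}_{L_f\cap H_\gamma}r^{H_\gamma}_{L_f\cap H_\gamma}c_{\gamma,H}(a_{f(\gamma H)})\Bigr),$$ the sum running over the $L$-orbits of functions $f\colon L/H\to\{0,1\}$, with stabilizers $L_f$; and for $K\le H\le L$ and $a\in T(G/K)$, $$N^L_H(t^H_K(a))=\sum_{[s]}t^L_{L_s}\Bigl(\prod_{[\gamma]\in L_s\backslash L/H}N^{L_s}_{L_s\cap \delta K\delta^{-1}}r^{\delta K\delta^{-1}}_{L_s\cap \delta K\delta^{-1}}c_{\delta,K}(a)\Bigr),\qquad \delta K=s(\gamma H),$$ the sum running over the $L$-orbits (under conjugation) of set-theoretic sections $s$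 of the projection $L/K\to L/H$, with stabilizers $L_s$. A \emph{Tambara ideal} $I$ of $T$ is a family of ideals $I(G/H)\subseteq T(G/H)$, $H\le G$, that is closed under all $r^H_K$, $t^H_K$, $N^H_K$ and satisfies $c_{g,H}(I(G/H))=I(G/gHg^{-1})$. It is \emph{proper} if $1\notin I(G/G)$. Tambara ideals are ordered by levelwise inclusion, and the product $IJ$ is the smallest Tambara ideal containing $I(G/H)\cdot J(G/H)$ for all $H\le G$. A proper Tambara ideal $P$ is \emph{prime} if $IJ\subseteq P$ implies $I\subseteq P$ or $J\subseteq P$, for all Tambara ideals $I,J$. The \emph{Nakaoka spectrum} $\mathrm{Spec}_{\mathrm{Nak}}(T)$ is the set of all prime Tambara ideals of $T$, with the topology for which the sets $V_H(x)=\{P\mid x\in P(G/H)\}$, for $H\le G$ and $x\in T(G/H)$, form a subbasis of closed sets. \textbf{Theorem.} For every finite group $G$ and every $G$-Tambara functor $T$, the Nakaoka spectrum $\mathrm{Spec}_{\mathrm{Nak}}(T)$ is a spectral space; that is, it is compact, $T_0$ and sober, its compact open subsets form a basis of the topology, and the intersection of any two compact open subsets is compact. -/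

import Mathlib

open scoped Pointwise

universe u v

namespace Tambara

section Cosets

variable {G : Type u} [Group G]

/-- The set of left cosets `L/H`, for subgroups `H ≤ L` of `G`, with `L` acting by left
translation. -/
abbrev Cosets (L H : Subgroup G) : Type u := L ⧸ H.subgroupOf L

/-- A representative in `G` of a coset `x ∈ L/H`. -/
noncomputable def rep {L H : Subgroup G} (x : Cosets L H) : G := ((Quotient.out x : L) : G)

/-- For a subgroup `S` of `L`, the set `S \ L / H` of double cosets, as the set of `S`-orbits
of `L/H`. -/
abbrev DoubleCosets (L H : Subgroup G) (S : Subgroup L) : Type u :=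
  MulAction.orbitRel.Quotient S (Cosets L H)

/-- A coset in `L/H` representing a given double coset in `S \ L / H`. -/
noncomputable def DoubleCosets.point {L H : Subgroup G} {S : Subgroup L}
    (q : DoubleCosets L H S) : Cosets L H := Quotient.out q

/-- A function from `L/H` to a set with two elements. -/
@[ext]
structure Labelling (L H : Subgroup G) : Type u where
  /-- the underlying function -/
  toFun : Cosets L H → Bool

/-- `L` acts on labellings by `(l • f) x = f (l⁻¹ • x)`. -/
instance (L H : Subgroup G) : MulAction L (Labelling L H) where
  smul l f := ⟨fun x => f.toFun (l⁻¹ • x)⟩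
  one_smul f := by
    ext x
    change f.toFun ((1 : L)⁻¹ • x) = f.toFun x
    simp
  mul_smul l m f := by
    ext x
    change f.toFun ((l * m)⁻¹ • x) = f.toFun (m⁻¹ • l⁻¹ • x)
    rw [mul_inv_rev, mul_smul]

/-- The projection `L/K → L/H`, for `K ≤ H ≤ L`. -/
def proj {K H : Subgroup G} (L : Subgroup G) (hKH : K ≤ H) : Cosets L K → Cosets L H :=
  Subgroup.quotientMapOfLE (Subgroup.subgroupOf_mono L hKH)

theorem proj_smul {K H : Subgroup G} (L : Subgroup G) (hKH : K ≤ H) (l : L) (x : Cosets L K) :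
    proj L hKH (l • x) = l • proj L hKH x := by
  induction x using QuotientGroup.induction_on with
  | H z => rfl

/-- A section (not required to be equivariant) of the projection `L/K → L/H`. -/
@[ext]
structure CosetSection {K H : Subgroup G} (L : Subgroup G) (hKH : K ≤ H) : Type u where
  /-- the underlying function -/
  toFun : Cosets L H → Cosets L K
  proj_toFun : ∀ x, proj L hKH (toFun x) = x

/-- `L` acts on sections by `(l • s) x = l • s (l⁻¹ • x)`. -/
instance {K H : Subgroup G} (L : Subgroup G) (hKH : K ≤ H) :
    MulAction L (CosetSection L hKH) where
  smul l s := ⟨fun x => l • s.toFun (l⁻¹ • x), fun x => by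
    rw [proj_smul, s.proj_toFun, smul_inv_smul]⟩
  one_smul s := by
    ext x
    change (1 : L) • s.toFun ((1 : L)⁻¹ • x) = s.toFun x
    simp
  mul_smul l m s := by
    ext x
    change (l * m) • s.toFun ((l * m)⁻¹ • x) = l • m • s.toFun (m⁻¹ • l⁻¹ • x)
    rw [mul_inv_rev, mul_smul, mul_smul]

/-- The stabilizer in `L` of a point of an `L`-set, as a subgroup of `G`. -/
def stab {L : Subgroup G} {X : Type u} [MulAction L X] (x : X) : Subgroup G :=
  (MulAction.stabilizer L x).map L.subtype

theorem stab_le {L : Subgroup G} {X : Type u} [MulAction L X] (x : X) :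
    stab (L := L) x ≤ L :=
  Subgroup.map_subtype_le _

end Cosets

/-- The data underlying a Tambara functor: commutative rings `T(G/H)` for all subgroups `H` of
`G`, with restrictions, transfers, norms and conjugations. The conjugation `c_{g,H}` is
`conj g rfl`; the target is allowed to be any subgroup equal to `gHg⁻¹`. -/
structure PreFunctor (G : Type u) [Group G] where
  /-- the ring `T(G/H)` -/
  obj : Subgroup G → Type v
  [commRing : ∀ H, CommRing (obj H)]
  /-- restriction -/
  res {K H : Subgroup G} (h : K ≤ H) : obj H →+* obj K
  /-- transfer -/
  tr {K H : Subgroup G} (h : K ≤ H) : obj K →+ obj H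
  /-- norm -/
  nm {K H : Subgroup G} (h : K ≤ H) : obj K →* obj H
  /-- conjugation -/
  conj (g : G) {H H' : Subgroup G} (h : MulAut.conj g • H = H') : obj H ≃+* obj H'

attribute [instance] PreFunctor.commRing

namespace PreFunctor

variable {G : Type u} [Group G] (T : PreFunctor.{u, v} G)

/-- For `a ∈ T(G/K)` and `g ∈ G`, the restriction of `c_{g,K}(a)` from `gKg⁻¹` to
`S ∩ gKg⁻¹`. -/
def resConj (S : Subgroup G) {K : Subgroup G} (g : G) (a : T.obj K) :
    T.obj (S ⊓ MulAut.conj g • K) :=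
  T.res inf_le_right (T.conj g rfl a)

/-- The transfer to `S` of the restriction of `c_{g,K}(a)` to `S ∩ gKg⁻¹`. -/
def trConj (S : Subgroup G) {K : Subgroup G} (g : G) (a : T.obj K) : T.obj S :=
  T.tr inf_le_left (T.resConj S g a)

/-- The norm to `S` of the restriction of `c_{g,K}(a)` to `S ∩ gKg⁻¹`. -/
def nmConj (S : Subgroup G) {K : Subgroup G} (g : G) (a : T.obj K) : T.obj S :=
  T.nm inf_le_left (T.resConj S g a)

end PreFunctor

/-- A `G`-Tambara functor, for a finite group `G`. -/
structure TambaraFunctor (G : Type u) [Group G] [Finite G] extends PreFunctor.{u, v} G where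
  -- functoriality
  res_refl {H : Subgroup G} (x : obj H) : res (le_refl H) x = x
  tr_refl {H : Subgroup G} (x : obj H) : tr (le_refl H) x = x
  nm_refl {H : Subgroup G} (x : obj H) : nm (le_refl H) x = x
  res_res {L K H : Subgroup G} (hLK : L ≤ K) (hKH : K ≤ H) (x : obj H) :
    res hLK (res hKH x) = res (hLK.trans hKH) x
  tr_tr {L K H : Subgroup G} (hLK : L ≤ K) (hKH : K ≤ H) (x : obj L) :
    tr hKH (tr hLK x) = tr (hLK.trans hKH) x
  nm_nm {L K H : Subgroup G} (hLK : L ≤ K) (hKH : K ≤ H) (x : obj L) :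
    nm hKH (nm hLK x) = nm (hLK.trans hKH) x
  conj_of_mem {H : Subgroup G} (g : G) (_hg : g ∈ H) (h : MulAut.conj g • H = H) (x : obj H) :
    conj g h x = x
  conj_conj {H H' H'' : Subgroup G} (g k : G) (hk : MulAut.conj k • H = H')
    (hg : MulAut.conj g • H' = H'') (hgk : MulAut.conj (g * k) • H = H'') (x : obj H) :
    conj g hg (conj k hk x) = conj (g * k) hgk x
  -- compatibility with conjugation
  conj_res {K H K' H' : Subgroup G} (g : G) (hK : MulAut.conj g • K = K')
    (hH : MulAut.conj g • H = H') (h : K ≤ H) (h' : K' ≤ H') (x : obj H) :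
    conj g hK (res h x) = res h' (conj g hH x)
  conj_tr {K H K' H' : Subgroup G} (g : G) (hK : MulAut.conj g • K = K')
    (hH : MulAut.conj g • H = H') (h : K ≤ H) (h' : K' ≤ H') (x : obj K) :
    conj g hH (tr h x) = tr h' (conj g hK x)
  conj_nm {K H K' H' : Subgroup G} (g : G) (hK : MulAut.conj g • K = K')
    (hH : MulAut.conj g • H = H') (h : K ≤ H) (h' : K' ≤ H') (x : obj K) :
    conj g hH (nm h x) = nm h' (conj g hK x)
  -- additive double coset formula, the sum running over `L \ K / H`
  res_tr {H L K : Subgroup G} (hH : H ≤ K) (hL : L ≤ K) (a : obj H) :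
    res hL (tr hH a) =
      ∑ᶠ q : DoubleCosets K H (L.subgroupOf K), toPreFunctor.trConj L (rep q.point) a
  -- multiplicative double coset formula, the product running over `L \ K / H`
  res_nm {H L K : Subgroup G} (hH : H ≤ K) (hL : L ≤ K) (a : obj H) :
    res hL (nm hH a) =
      ∏ᶠ q : DoubleCosets K H (L.subgroupOf K), toPreFunctor.nmConj L (rep q.point) a
  -- Frobenius reciprocity
  tr_res_mul {K H : Subgroup G} (h : K ≤ H) (x : obj H) (y : obj K) :
    tr h (res h x * y) = x * tr h y
  -- Tambara reciprocity for sums: the sum runs over the `L`-orbits of functions `f` from `L/H`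
  -- to a two-element set, and the product over the orbits in `L/H` of the stabilizer of `f`
  nm_add {H L : Subgroup G} (h : H ≤ L) (a b : obj H) :
    nm h (a + b) =
      ∑ᶠ o : MulAction.orbitRel.Quotient L (Labelling L H),
        tr (stab_le (Quotient.out o))
          (∏ᶠ q : DoubleCosets L H (MulAction.stabilizer L (Quotient.out o)),
            toPreFunctor.nmConj (stab (Quotient.out o)) (rep q.point)
              (bif (Quotient.out o).toFun q.point then a else b))
  -- Tambara reciprocity for transfers: the sum runs over the `L`-orbits of sections `s` of
  -- `L/K → L/H`, and the product over the orbits in `L/H` of the stabilizer of `s`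
  nm_tr {K H L : Subgroup G} (hKH : K ≤ H) (hHL : H ≤ L) (a : obj K) :
    nm hHL (tr hKH a) =
      ∑ᶠ o : MulAction.orbitRel.Quotient L (CosetSection L hKH),
        tr (stab_le (Quotient.out o))
          (∏ᶠ q : DoubleCosets L H (MulAction.stabilizer L (Quotient.out o)),
            toPreFunctor.nmConj (stab (Quotient.out o)) (rep ((Quotient.out o).toFun q.point)) a)

variable {G : Type u} [Group G] [Finite G]

/-- A Tambara ideal. -/
@[ext]
structure TambaraIdeal (T : TambaraFunctor.{u, v} G) where
  /-- the ideal `I(G/H)` of the ring `T(G/H)` -/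
  level : ∀ H : Subgroup G, Ideal (T.obj H)
  res_mem {K H : Subgroup G} (h : K ≤ H) {x : T.obj H} : x ∈ level H → T.res h x ∈ level K
  tr_mem {K H : Subgroup G} (h : K ≤ H) {x : T.obj K} : x ∈ level K → T.tr h x ∈ level H
  nm_mem {K H : Subgroup G} (h : K ≤ H) {x : T.obj K} : x ∈ level K → T.nm h x ∈ level H
  conj_image (g : G) {H H' : Subgroup G} (h : MulAut.conj g • H = H') :
    T.conj g h '' (level H : Set (T.obj H)) = (level H' : Set (T.obj H'))

namespace TambaraIdeal

variable {T : TambaraFunctor.{u, v} G}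

/-- Tambara ideals are ordered by levelwise inclusion. -/
instance : PartialOrder (TambaraIdeal T) :=
  PartialOrder.lift TambaraIdeal.level fun _ _ h => TambaraIdeal.ext h

/-- A Tambara ideal is proper if its level at `G/G` does not contain `1`. -/
def IsProper (I : TambaraIdeal T) : Prop := (1 : T.obj ⊤) ∉ I.level ⊤

/-- The Tambara ideal generated by a family of subsets of the rings `T(G/H)`: the levelwise
intersection of all Tambara ideals that contain these subsets. -/
def span (X : ∀ H : Subgroup G, Set (T.obj H)) : TambaraIdeal T where
  level H := ⨅ J : {J : TambaraIdeal T // ∀ K, X K ⊆ J.level K}, J.1.level H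
  res_mem {K H} h {x} hx := by
    rw [Submodule.mem_iInf] at hx ⊢
    exact fun J => J.1.res_mem h (hx J)
  tr_mem {K H} h {x} hx := by
    rw [Submodule.mem_iInf] at hx ⊢
    exact fun J => J.1.tr_mem h (hx J)
  nm_mem {K H} h {x} hx := by
    rw [Submodule.mem_iInf] at hx ⊢
    exact fun J => J.1.nm_mem h (hx J)
  conj_image g {H H'} h := by
    ext y
    simp only [Set.mem_image, SetLike.mem_coe, Submodule.mem_iInf]
    constructor
    · rintro ⟨x, hx, rfl⟩ J
      have hJ := J.1.conj_image g h
      exact hJ.subset ⟨x, hx J, rfl⟩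
    · intro hy
      refine ⟨(T.conj g h).symm y, fun J => ?_, RingEquiv.apply_symm_apply _ _⟩
      obtain ⟨x, hx, hxy⟩ := (J.1.conj_image g h).superset (hy J)
      rw [← hxy, RingEquiv.symm_apply_apply]
      exact hx

/-- The product of two Tambara ideals: the Tambara ideal generated by the levelwise products. -/
instance : Mul (TambaraIdeal T) where
  mul I J := span fun H => ((I.level H * J.level H : Ideal (T.obj H)) : Set (T.obj H))

/-- A Tambara ideal is prime if it is proper and contains a product of two Tambara ideals only
if it contains one of the factors. -/
structure IsPrime (P : TambaraIdeal T) : Prop where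
  proper : P.IsProper
  le_or_le : ∀ I J : TambaraIdeal T, I * J ≤ P → I ≤ P ∨ J ≤ P

end TambaraIdeal

/-- The set underlying the Nakaoka spectrum: the prime Tambara ideals. -/
def NakaokaSpectrum (T : TambaraFunctor.{u, v} G) : Type (max u v) :=
  {P : TambaraIdeal T // P.IsPrime}

namespace NakaokaSpectrum

variable (T : TambaraFunctor.{u, v} G)

/-- The set of all prime Tambara ideals `P` with `x ∈ P(G/H)`. -/
def vanishing {H : Subgroup G} (x : T.obj H) : Set (NakaokaSpectrum T) :=
  {P | x ∈ P.1.level H}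

/-- The topology for which the sets `vanishing T x` form a subbasis of closed sets. -/
instance : TopologicalSpace (NakaokaSpectrum T) :=
  TopologicalSpace.generateFrom
    {U | ∃ (H : Subgroup G) (x : T.obj H), U = (vanishing T x)ᶜ}

end NakaokaSpectrum

end Tambara

namespace Tambara

variable {G : Type u} [Group G] [Finite G]

/-! The algebraic core is that a product of two finitely generated Tambara ideals is finitely
generated (`FG.mul`). If a family of sets is closed under multiples, restrictions, norms and
conjugations, then the sums of transfers of its elements already form a Tambara ideal; stability
under norms (`nm_mem_transferClosure`) rests on Tambara reciprocity. So the ideal generated by `X`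
consists of sums of transfers of multiples of norms of restrictions of conjugates of elements of
`X`. As `G` is finite, a finite `X` gives finitely many such norms, and Frobenius reciprocity shows
that their levelwise products generate the product ideal.

The rest follows commutative algebra. Finitely generated ideals are compact in the lattice of
Tambara ideals, and a Zorn argument gives a prime containing `J` but not a finitely generated `I`
unless an iterated square of `I` lies in `J`. Hence the complements of zero loci of finitely
generated ideals are compact; they form a basis closed under intersection. An irreducible closed set
has as generic point the infimum of its members. -/

instance (L H : Subgroup G) : Finite (Labelling L H) :=
  Finite.of_injective Labelling.toFun fun _ _ h => Labelling.ext h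

instance {K H : Subgroup G} (L : Subgroup G) (hKH : K ≤ H) : Finite (CosetSection L hKH) :=
  Finite.of_injective CosetSection.toFun fun _ _ h => CosetSection.ext h

instance (L H : Subgroup G) (S : Subgroup L) : Nonempty (DoubleCosets L H S) :=
  ⟨Quotient.mk _ (QuotientGroup.mk 1)⟩

theorem dvd_finprod {ι M : Type*} [Finite ι] [CommMonoid M] (f : ι → M) (i : ι) :
    f i ∣ ∏ᶠ j, f j := by
  have := Fintype.ofFinite ι
  rw [finprod_eq_prod_of_fintype]
  exact Finset.dvd_prod_of_mem f (Finset.mem_univ i)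

omit [Finite G] in
theorem rep_mem {L H : Subgroup G} (x : Cosets L H) : rep x ∈ L := (Quotient.out x : L).2

omit [Finite G] in
theorem conj_smul_le {g : G} {H L : Subgroup G} (hg : g ∈ L) (h : H ≤ L) :
    MulAut.conj g • H ≤ L := by
  rintro _ ⟨x, hx, rfl⟩
  exact L.mul_mem (L.mul_mem hg (h hx)) (L.inv_mem hg)

omit [Finite G] in
theorem conj_smul_eq {g : G} {L : Subgroup G} (hg : g ∈ L) : MulAut.conj g • L = L :=
  Subgroup.conj_smul_eq_self_of_mem hg

variable {T : TambaraFunctor.{u, v} G}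

/-! ### Absorbing families and sums of transfers. -/

/-- A family of subsets of the rings `T(G/H)` that contains zero and is closed under multiplication
by ring elements, restrictions, norms and conjugations. -/
structure IsAbsorbing (S : ∀ H : Subgroup G, Set (T.obj H)) : Prop where
  zero_mem (H : Subgroup G) : (0 : T.obj H) ∈ S H
  mul_mem {H : Subgroup G} (c : T.obj H) {x : T.obj H} : x ∈ S H → c * x ∈ S H
  res_mem {K H : Subgroup G} (h : K ≤ H) {x : T.obj H} : x ∈ S H → T.res h x ∈ S K
  nm_mem {K H : Subgroup G} (h : K ≤ H) {x : T.obj K} : x ∈ S K → T.nm h x ∈ S H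
  conj_mem (g : G) {H H' : Subgroup G} (h : MulAut.conj g • H = H') {x : T.obj H} :
    x ∈ S H → T.conj g h x ∈ S H'

/-- The additive closure of the transfers of the elements of a family of sets. -/
def transferClosure (S : ∀ H : Subgroup G, Set (T.obj H)) (H : Subgroup G) :
    AddSubmonoid (T.obj H) :=
  AddSubmonoid.closure {y | ∃ (L : Subgroup G) (h : L ≤ H), ∃ x ∈ S L, y = T.tr h x}

theorem tr_mem_transferClosure_of_mem {S : ∀ H : Subgroup G, Set (T.obj H)} {L H : Subgroup G}
    (h : L ≤ H) {x : T.obj L} (hx : x ∈ S L) : T.tr h x ∈ transferClosure S H :=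
  AddSubmonoid.subset_closure ⟨L, h, x, hx, rfl⟩

theorem mem_transferClosure_of_mem {S : ∀ H : Subgroup G, Set (T.obj H)} {H : Subgroup G}
    {x : T.obj H} (hx : x ∈ S H) : x ∈ transferClosure S H := by
  simpa only [T.tr_refl] using tr_mem_transferClosure_of_mem le_rfl hx

@[elab_as_elim]
theorem transferClosure_induction {S : ∀ H : Subgroup G, Set (T.obj H)} {H : Subgroup G}
    {motive : (x : T.obj H) → x ∈ transferClosure S H → Prop} (zero : motive 0 (zero_mem _))
    (add : ∀ x y hx hy, motive x hx → motive y hy → motive (x + y) (add_mem hx hy))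
    (tr : ∀ {L : Subgroup G} (h : L ≤ H) (x : T.obj L) (hx : x ∈ S L),
      motive (T.tr h x) (tr_mem_transferClosure_of_mem h hx))
    {x : T.obj H} (hx : x ∈ transferClosure S H) : motive x hx := by
  refine AddSubmonoid.closure_induction (motive := motive) ?_ zero add hx
  rintro _ ⟨L, h, x, hx, rfl⟩
  exact tr h x hx

theorem tr_mem_transferClosure {K H : Subgroup G} (h : K ≤ H) {x : T.obj K}
    (hx : x ∈ transferClosure S K) : T.tr h x ∈ transferClosure S H := by
  induction hx using transferClosure_induction with
  | zero => rw [map_zero]; exact zero_mem _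
  | add x y _ _ hx hy => rw [map_add]; exact add_mem hx hy
  | tr h' x hx => rw [T.tr_tr]; exact tr_mem_transferClosure_of_mem _ hx

theorem nm_res_of_eq {A B L : Subgroup G} (hAL : A ≤ L) (hAB : A ≤ B) (hBL : B ≤ L) (e : A = B)
    (w : T.obj B) : T.nm hAL (T.res hAB w) = T.nm hBL w := by
  subst e
  rw [T.res_refl]

/-- For `g ∈ L` the group `gHg⁻¹` lies in `L`, and conjugation by `g` is trivial on `T(G/L)`, so the
norm does not see `g`. This settles the case of `nm_mem_transferClosure` where the stabilizer is all
of `L`. -/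
theorem nmConj_eq_nm {H L S : Subgroup G} (h : H ≤ L) (hS : S = L) {g : G} (hg : g ∈ L)
    (x : T.obj H) : T.nmConj S g x = T.nm (h.trans hS.ge) x := by
  subst hS
  unfold PreFunctor.nmConj PreFunctor.resConj
  rw [nm_res_of_eq _ _ (conj_smul_le hg h) (inf_eq_right.2 (conj_smul_le hg h)),
    ← T.conj_nm g rfl (conj_smul_eq hg) h, T.conj_of_mem g hg]

namespace IsAbsorbing

variable {S : ∀ H : Subgroup G, Set (T.obj H)} (hS : IsAbsorbing S)
include hS

theorem nmConj_mem {K : Subgroup G} (L : Subgroup G) (g : G) {x : T.obj K} (hx : x ∈ S K) :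
    T.nmConj L g x ∈ S L :=
  hS.nm_mem _ (hS.res_mem _ (hS.conj_mem _ _ hx))

theorem mem_of_dvd {H : Subgroup G} {x y : T.obj H} (h : x ∣ y) (hx : x ∈ S H) : y ∈ S H := by
  obtain ⟨c, rfl⟩ := h
  rw [mul_comm]
  exact hS.mul_mem c hx

theorem mul_mem_transferClosure {H : Subgroup G} (c : T.obj H) {x : T.obj H}
    (hx : x ∈ transferClosure S H) : c * x ∈ transferClosure S H := by
  induction hx using transferClosure_induction with
  | zero => rw [mul_zero]; exact AddSubmonoid.zero_mem _
  | add x y _ _ hx hy => rw [mul_add]; exact add_mem hx hy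
  | tr h x hx =>
    rw [← T.tr_res_mul]
    exact tr_mem_transferClosure_of_mem _ (hS.mul_mem _ hx)

theorem conj_mem_transferClosure (g : G) {H H' : Subgroup G} (h : MulAut.conj g • H = H')
    {x : T.obj H} (hx : x ∈ transferClosure S H) : T.conj g h x ∈ transferClosure S H' := by
  induction hx using transferClosure_induction with
  | zero => rw [map_zero]; exact AddSubmonoid.zero_mem _
  | add x y _ _ hx hy => rw [map_add]; exact add_mem hx hy
  | @tr L hL x hx =>
    have hL' : MulAut.conj g • L ≤ H' := by
      rw [← h]; exact Subgroup.pointwise_smul_le_pointwise_smul_iff.2 hL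
    rw [T.conj_tr g rfl h hL hL']
    exact tr_mem_transferClosure_of_mem _ (hS.conj_mem _ _ hx)

theorem res_mem_transferClosure {K H : Subgroup G} (h : K ≤ H) {x : T.obj H}
    (hx : x ∈ transferClosure S H) : T.res h x ∈ transferClosure S K := by
  induction hx using transferClosure_induction with
  | zero => rw [map_zero]; exact AddSubmonoid.zero_mem _
  | add x y _ _ hx hy => rw [map_add]; exact add_mem hx hy
  | tr hL x hx =>
    rw [T.res_tr]
    exact finsum_induction (· ∈ transferClosure S K) (AddSubmonoid.zero_mem _) (fun _ _ => add_mem)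
      fun q => tr_mem_transferClosure_of_mem _ (hS.res_mem _ (hS.conj_mem _ _ hx))

/-- Outer induction on the target `L`, inner induction on the element. Reciprocity writes the norm
as a sum of transfers of products; since the closure absorbs multiples, one good factor in each
product is enough. `H` stays general because the factors are norms from other subgroups. -/
theorem nm_mem_transferClosure {L : Subgroup G} : ∀ {H : Subgroup G} (h : H ≤ L) {x : T.obj H},
    x ∈ transferClosure S H → T.nm h x ∈ transferClosure S L := by
  induction L using WellFoundedLT.induction with
  | ind L ih =>
  intro H h x hx
  induction hx using transferClosure_induction with
  -- That the norm of `0` is `0` is not among the axioms; closure of `S` under norms suffices.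
  | zero => exact mem_transferClosure_of_mem (hS.nm_mem h (hS.zero_mem H))
  | tr hK x hx =>
    rw [T.nm_tr]
    refine finsum_induction (· ∈ transferClosure S L) (AddSubmonoid.zero_mem _) (fun _ _ => add_mem)
      fun o => tr_mem_transferClosure_of_mem _ ?_
    exact hS.mem_of_dvd (dvd_finprod _ (Classical.arbitrary _)) (hS.nmConj_mem _ _ hx)
  | add x y hx hy hnx hny =>
    rw [T.nm_add]
    refine finsum_induction (· ∈ transferClosure S L) (AddSubmonoid.zero_mem _) (fun _ _ => add_mem)
      fun o => tr_mem_transferClosure _ ?_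
    obtain ⟨c, hc⟩ := dvd_finprod
      (fun q : DoubleCosets L H (MulAction.stabilizer L (Quotient.out o)) =>
        T.nmConj (stab (L := L) (Quotient.out o)) (rep q.point)
          (bif (Quotient.out o).toFun q.point then x else y)) (Classical.arbitrary _)
    rw [hc, mul_comm]
    refine hS.mul_mem_transferClosure _ ?_
    generalize hz : (bif _ then x else y) = z
    generalize hA : stab (L := L) (Quotient.out o) = A
    have hAL : A ≤ L := hA ▸ stab_le _
    have hz : z ∈ transferClosure S H ∧ T.nm h z ∈ transferClosure S L := by
      rw [← hz]
      cases (Quotient.out o).toFun _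
      exacts [⟨hy, hny⟩, ⟨hx, hnx⟩]
    -- A proper stabilizer falls under the outer induction; otherwise the factor is the norm of `x`
    -- or `y` itself, covered by the inner one.
    rcases hAL.lt_or_eq with hlt | rfl
    · exact ih A hlt _ (hS.res_mem_transferClosure _ (hS.conj_mem_transferClosure _ _ hz.1))
    · rw [nmConj_eq_nm h rfl (rep_mem _)]
      exact hz.2

end IsAbsorbing

/-! ### Tambara ideals generated by absorbing families. -/

namespace TambaraIdeal

theorem conj_mem (I : TambaraIdeal T) (g : G) {H H' : Subgroup G} (h : MulAut.conj g • H = H')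
    {x : T.obj H} (hx : x ∈ I.level H) : T.conj g h x ∈ I.level H' :=
  (I.conj_image g h).subset ⟨x, hx, rfl⟩

/-- The Tambara ideal generated by an absorbing family of sets, given as the additive closure of the
transfers. -/
def ofAbsorbing (S : ∀ H : Subgroup G, Set (T.obj H)) (hS : IsAbsorbing S) : TambaraIdeal T where
  level H := { transferClosure S H with smul_mem' := fun c _ => hS.mul_mem_transferClosure c }
  res_mem h _ := hS.res_mem_transferClosure h
  tr_mem h _ := Tambara.tr_mem_transferClosure h
  nm_mem h _ := hS.nm_mem_transferClosure h
  conj_image g {H H'} h := by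
    refine Set.Subset.antisymm ?_ fun y hy => ?_
    · rintro _ ⟨x, hx, rfl⟩
      exact hS.conj_mem_transferClosure g h hx
    · have h' : MulAut.conj g⁻¹ • H' = H := by rw [← h, map_inv, inv_smul_smul]
      refine ⟨T.conj g⁻¹ h' y, hS.conj_mem_transferClosure _ _ hy, ?_⟩
      have h1 : MulAut.conj (g * g⁻¹) • H' = H' := by simp
      rw [T.conj_conj g g⁻¹ h' h h1, T.conj_of_mem]
      rw [mul_inv_cancel]
      exact H'.one_mem

theorem mem_ofAbsorbing {S : ∀ H : Subgroup G, Set (T.obj H)} (hS : IsAbsorbing S)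
    {H : Subgroup G} {x : T.obj H} :
    x ∈ (ofAbsorbing S hS).level H ↔ x ∈ transferClosure S H := Iff.rfl

theorem ofAbsorbing_le_iff {S : ∀ H : Subgroup G, Set (T.obj H)} (hS : IsAbsorbing S)
    {J : TambaraIdeal T} : ofAbsorbing S hS ≤ J ↔ ∀ H, S H ⊆ J.level H := by
  refine ⟨fun h H x hx => h H (mem_transferClosure_of_mem hx), fun h H x hx => ?_⟩
  replace hx : x ∈ transferClosure S H := hx
  induction hx using transferClosure_induction with
  | zero => exact zero_mem _
  | add x y _ _ hx hy => exact add_mem hx hy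
  | tr hL x hx => exact J.tr_mem hL (h _ hx)

theorem span_le_iff {X : ∀ H : Subgroup G, Set (T.obj H)} {J : TambaraIdeal T} :
    span X ≤ J ↔ ∀ H, X H ⊆ J.level H := by
  refine ⟨fun h H x hx => h H ?_, fun h H => iInf_le_of_le ⟨J, h⟩ le_rfl⟩
  exact (Submodule.mem_iInf _).2 fun K => K.2 H hx

theorem subset_span (X : ∀ H : Subgroup G, Set (T.obj H)) (H : Subgroup G) :
    X H ⊆ (span X).level H :=
  span_le_iff.1 le_rfl H

theorem mul_le_iff {I J Q : TambaraIdeal T} :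
    I * J ≤ Q ↔ ∀ H, ∀ x ∈ I.level H, ∀ y ∈ J.level H, x * y ∈ Q.level H :=
  span_le_iff.trans (forall_congr' fun _ => Ideal.mul_le)

/-- By Frobenius reciprocity `tr x * y = tr (x * res y)`, and `res y` is again a sum of transfers
from `S'`. A second application leaves only products of an element of `S` and one of `S'`. -/
theorem ofAbsorbing_mul_le {S S' : ∀ H : Subgroup G, Set (T.obj H)} (hS : IsAbsorbing S)
    (hS' : IsAbsorbing S') {Q : TambaraIdeal T}
    (h : ∀ H, ∀ x ∈ S H, ∀ y ∈ S' H, x * y ∈ Q.level H) :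
    ofAbsorbing S hS * ofAbsorbing S' hS' ≤ Q := by
  rw [mul_le_iff]
  intro H x hx y hy
  replace hx : x ∈ transferClosure S H := hx
  induction hx using transferClosure_induction with
  | zero => rw [zero_mul]; exact zero_mem _
  | add x y hx hy hx' hy' => rw [add_mul]; exact add_mem hx' hy'
  | tr hL x hx =>
    rw [mul_comm, ← T.tr_res_mul]
    refine Q.tr_mem hL ?_
    have hz := hS'.res_mem_transferClosure hL hy
    generalize T.res hL y = z at hz ⊢
    induction hz using transferClosure_induction with
    | zero => rw [zero_mul]; exact zero_mem _
    | add x y hx hy hx' hy' => rw [add_mul]; exact add_mem hx' hy'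
    | tr hM y hy =>
      rw [mul_comm, ← T.tr_res_mul]
      exact Q.tr_mem hM (h _ _ (hS.res_mem hM hx) _ hy)

end TambaraIdeal

/-! ### Explicit generators. -/

/-- The norms to `T(G/L)` of restrictions of conjugates of elements of the family `X`. -/
def conjNorms (X : ∀ H : Subgroup G, Set (T.obj H)) (L : Subgroup G) : Set (T.obj L) :=
  ⋃ (H : Subgroup G) (g : G) (M : Subgroup G) (hM : M ≤ MulAut.conj g • H) (hL : M ≤ L),
    (fun a => T.nm hL (T.res hM (T.conj g rfl a))) '' X H

theorem conjNorms_finite {X : ∀ H : Subgroup G, Set (T.obj H)} (hX : ∀ H, (X H).Finite)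
    (L : Subgroup G) : (conjNorms X L).Finite :=
  Set.finite_iUnion fun H => Set.finite_iUnion fun _ => Set.finite_iUnion fun _ =>
    Set.finite_iUnion fun _ => Set.finite_iUnion fun _ => (hX H).image _

/-- The variable `H'` with its equation admits composite conjugations, whose targets agree only
propositionally. -/
theorem nm_res_conj_mem_conjNorms {X : ∀ H : Subgroup G, Set (T.obj H)} {H H' M L : Subgroup G}
    {g : G} (hg : MulAut.conj g • H = H') (hM : M ≤ H') (hL : M ≤ L) {a : T.obj H} (ha : a ∈ X H) :
    T.nm hL (T.res hM (T.conj g hg a)) ∈ conjNorms X L := by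
  subst hg
  simp only [conjNorms, Set.mem_iUnion]
  exact ⟨H, g, M, hM, hL, a, ha, rfl⟩

theorem exists_of_mem_conjNorms {X : ∀ H : Subgroup G, Set (T.obj H)} {L : Subgroup G} {x : T.obj L}
    (hx : x ∈ conjNorms X L) : ∃ (H K M : Subgroup G) (g : G) (hg : MulAut.conj g • H = K)
      (hM : M ≤ K) (hL : M ≤ L), ∃ a ∈ X H, x = T.nm hL (T.res hM (T.conj g hg a)) := by
  simp only [conjNorms, Set.mem_iUnion] at hx
  obtain ⟨H, g, M, hM, hL, a, ha, rfl⟩ := hx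
  exact ⟨H, _, M, g, rfl, hM, hL, a, ha, rfl⟩

theorem subset_conjNorms (X : ∀ H : Subgroup G, Set (T.obj H)) (H : Subgroup G) :
    X H ⊆ conjNorms X H := by
  intro x hx
  have h : MulAut.conj (1 : G) • H = H := by simp
  have := nm_res_conj_mem_conjNorms h le_rfl le_rfl hx
  rwa [T.nm_refl, T.res_refl, T.conj_of_mem 1 H.one_mem] at this

theorem TambaraIdeal.conjNorms_subset {X : ∀ H : Subgroup G, Set (T.obj H)} {I : TambaraIdeal T}
    (hI : ∀ H, X H ⊆ I.level H) (H : Subgroup G) : conjNorms X H ⊆ I.level H := by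
  intro x hx
  obtain ⟨K, K', M, g, hg, hM, hL, a, ha, rfl⟩ := exists_of_mem_conjNorms hx
  exact I.nm_mem hL (I.res_mem hM (I.conj_mem g hg (hI K ha)))

/-- The multiples of the norms of restrictions of conjugates of elements of `X`. -/
def absorbingHull (X : ∀ H : Subgroup G, Set (T.obj H)) (L : Subgroup G) : Set (T.obj L) :=
  {y | ∃ x ∈ conjNorms X L, x ∣ y}

/-- Norms compose and conjugations pass through norms and restrictions. The restriction of a norm is
only a product of elements of `conjNorms X`, by the double coset formula, which is why the hull is
taken with multiples. -/
theorem isAbsorbing_absorbingHull {X : ∀ H : Subgroup G, Set (T.obj H)}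
    (hX : ∀ H, (0 : T.obj H) ∈ X H) : IsAbsorbing (absorbingHull X) where
  zero_mem H := ⟨0, subset_conjNorms X H (hX H), dvd_rfl⟩
  mul_mem c x := by
    rintro ⟨y, hy, h⟩
    exact ⟨y, hy, h.mul_left c⟩
  nm_mem h x := by
    rintro ⟨y, hy, hyx⟩
    refine ⟨T.nm h y, ?_, map_dvd _ hyx⟩
    obtain ⟨K, K', M, g, hg, hM, hL, a, ha, rfl⟩ := exists_of_mem_conjNorms hy
    rw [T.nm_nm]
    exact nm_res_conj_mem_conjNorms hg hM _ ha
  conj_mem k {H H'} h x := by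
    rintro ⟨y, hy, hyx⟩
    refine ⟨T.conj k h y, ?_, map_dvd _ hyx⟩
    obtain ⟨K, K', M, g, hg, hM, hL, a, ha, rfl⟩ := exists_of_mem_conjNorms hy
    have hM' : MulAut.conj k • M ≤ MulAut.conj k • K' :=
      Subgroup.pointwise_smul_le_pointwise_smul_iff.2 hM
    have hL' : MulAut.conj k • M ≤ H' := by
      rw [← h]; exact Subgroup.pointwise_smul_le_pointwise_smul_iff.2 hL
    have hkg : MulAut.conj (k * g) • K = MulAut.conj k • K' := by rw [map_mul, mul_smul, hg]
    rw [T.conj_nm k rfl h hL hL', T.conj_res k rfl rfl hM hM', T.conj_conj k g hg rfl hkg]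
    exact nm_res_conj_mem_conjNorms hkg _ _ ha
  res_mem {N H} h x := by
    rintro ⟨y, hy, hyx⟩
    suffices ∃ z ∈ conjNorms X N, z ∣ T.res h y by
      obtain ⟨z, hz, hzy⟩ := this
      exact ⟨z, hz, hzy.trans (map_dvd _ hyx)⟩
    obtain ⟨K, K', M, g, hg, hM, hL, a, ha, rfl⟩ := exists_of_mem_conjNorms hy
    rw [T.res_nm]
    let q : DoubleCosets H M (N.subgroupOf H) := Classical.arbitrary _
    refine ⟨_, ?_, dvd_finprod _ q⟩
    generalize rep q.point = k
    have hM' : MulAut.conj k • M ≤ MulAut.conj k • K' :=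
      Subgroup.pointwise_smul_le_pointwise_smul_iff.2 hM
    have hkg : MulAut.conj (k * g) • K = MulAut.conj k • K' := by rw [map_mul, mul_smul, hg]
    unfold PreFunctor.nmConj PreFunctor.resConj
    rw [T.conj_res k rfl rfl hM hM', T.conj_conj k g hg rfl hkg, T.res_res]
    exact nm_res_conj_mem_conjNorms hkg _ _ ha

/-! ### The lattice of Tambara ideals and finite generation. -/

namespace TambaraIdeal

instance : InfSet (TambaraIdeal T) where
  sInf A := span fun H => {x | ∀ J ∈ A, x ∈ J.level H}

instance : CompleteLattice (TambaraIdeal T) :=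
  completeLatticeOfInf _ fun _ => ⟨fun J hJ => span_le_iff.2 fun _ _ hx => hx J hJ,
    fun _ hB H _ hx => subset_span _ H fun _ hJ => hB hJ H hx⟩

theorem span_eq_ofAbsorbing {X : ∀ H : Subgroup G, Set (T.obj H)}
    (hX : ∀ H, (0 : T.obj H) ∈ X H) :
    span X = ofAbsorbing _ (isAbsorbing_absorbingHull hX) := by
  refine le_antisymm (span_le_iff.2 fun H x hx => ?_) ((ofAbsorbing_le_iff _).2 fun H x => ?_)
  · exact mem_transferClosure_of_mem ⟨x, subset_conjNorms X H hx, dvd_rfl⟩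
  · rintro ⟨y, hy, hyx⟩
    exact Ideal.mem_of_dvd _ hyx (conjNorms_subset (subset_span X) H hy)

/-- A Tambara ideal is finitely generated if it is generated by a family of finite sets. -/
def FG (I : TambaraIdeal T) : Prop :=
  ∃ X : ∀ H : Subgroup G, Set (T.obj H), (∀ H, (X H).Finite) ∧ (∀ H, 0 ∈ X H) ∧ I = span X

theorem fg_span {X : ∀ H : Subgroup G, Set (T.obj H)} (hX : ∀ H, (X H).Finite) : (span X).FG := by
  refine ⟨fun H => insert 0 (X H), fun H => (hX H).insert 0, fun H => Set.mem_insert _ _,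
    le_antisymm (span_le_iff.2 fun H _ hx => subset_span _ H (Set.mem_insert_of_mem 0 hx))
      (span_le_iff.2 fun H => Set.insert_subset (zero_mem _) (subset_span _ H))⟩

/-- The levelwise products of the finite sets `conjNorms X H` and `conjNorms Y H` generate. The sets
`X H` and `Y H` are enlarged in this way because `ofAbsorbing_mul_le` needs absorbing families. -/
theorem FG.mul {I J : TambaraIdeal T} (hI : I.FG) (hJ : J.FG) : (I * J).FG := by
  obtain ⟨X, hX, hX0, rfl⟩ := hI
  obtain ⟨Y, hY, hY0, rfl⟩ := hJ
  convert fg_span (X := fun H => conjNorms X H * conjNorms Y H)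
    fun H => (conjNorms_finite hX H).mul (conjNorms_finite hY H)
  refine le_antisymm ?_ (span_le_iff.2 fun H => ?_)
  · rw [span_eq_ofAbsorbing hX0, span_eq_ofAbsorbing hY0]
    refine ofAbsorbing_mul_le _ _ fun H x hx y hy => ?_
    obtain ⟨x', hx', hx⟩ := hx
    obtain ⟨y', hy', hy⟩ := hy
    exact Ideal.mem_of_dvd _ (mul_dvd_mul hx hy) (subset_span _ H (Set.mul_mem_mul hx' hy'))
  · rintro _ ⟨x, hx, y, hy, rfl⟩
    exact mul_le_iff.1 le_rfl H _ (conjNorms_subset (subset_span X) H hx) _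
      (conjNorms_subset (subset_span Y) H hy)

theorem mul_le_left {I J : TambaraIdeal T} : I * J ≤ I :=
  mul_le_iff.2 fun _ _ hx y _ => Ideal.mul_mem_right y _ hx

theorem mul_le_right {I J : TambaraIdeal T} : I * J ≤ J :=
  mul_le_iff.2 fun _ x _ _ hy => Ideal.mul_mem_left _ x hy

theorem mul_mono {I I' J J' : TambaraIdeal T} (hI : I ≤ I') (hJ : J ≤ J') : I * J ≤ I' * J' :=
  mul_le_iff.2 fun H x hx y hy => mul_le_iff.1 le_rfl H x (hI H hx) y (hJ H hy)

theorem isAbsorbing_sUnion {A : Set (TambaraIdeal T)} (hA : A.Nonempty) :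
    IsAbsorbing fun H => {x : T.obj H | ∃ I ∈ A, x ∈ I.level H} where
  zero_mem _ := hA.imp fun _ hI => ⟨hI, zero_mem _⟩
  mul_mem c _ := fun ⟨I, hI, hx⟩ => ⟨I, hI, Ideal.mul_mem_left _ c hx⟩
  res_mem h _ := fun ⟨I, hI, hx⟩ => ⟨I, hI, I.res_mem h hx⟩
  nm_mem h _ := fun ⟨I, hI, hx⟩ => ⟨I, hI, I.nm_mem h hx⟩
  conj_mem g _ _ h _ := fun ⟨I, hI, hx⟩ => ⟨I, hI, I.conj_mem g h hx⟩

theorem sSup_eq_ofAbsorbing {A : Set (TambaraIdeal T)} (hA : A.Nonempty) :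
    sSup A = ofAbsorbing _ (isAbsorbing_sUnion hA) :=
  le_antisymm (sSup_le fun I hI _ _ hx => mem_transferClosure_of_mem ⟨I, hI, hx⟩)
    ((ofAbsorbing_le_iff _).2 fun H _ ⟨_, hI, hx⟩ => le_sSup hI H hx)

theorem mem_sSup_of_directedOn {A : Set (TambaraIdeal T)} (hA : A.Nonempty)
    (hd : DirectedOn (· ≤ ·) A) {H : Subgroup G} {x : T.obj H} :
    x ∈ (sSup A).level H ↔ ∃ I ∈ A, x ∈ I.level H := by
  refine ⟨fun hx => ?_, fun ⟨I, hI, hx⟩ => le_sSup hI H hx⟩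
  rw [sSup_eq_ofAbsorbing hA, mem_ofAbsorbing] at hx
  induction hx using transferClosure_induction with
  | zero => exact hA.imp fun _ hI => ⟨hI, zero_mem _⟩
  | add x y _ _ hx hy =>
    obtain ⟨I, hI, hx⟩ := hx
    obtain ⟨J, hJ, hy⟩ := hy
    obtain ⟨K, hK, hIK, hJK⟩ := hd I hI J hJ
    exact ⟨K, hK, add_mem (hIK H hx) (hJK H hy)⟩
  | tr h x hx => exact hx.imp fun I hI => ⟨hI.1, I.tr_mem h hI.2⟩

theorem FG.isCompactElement {I : TambaraIdeal T} (hI : I.FG) : IsCompactElement I := by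
  obtain ⟨X, hX, -, rfl⟩ := hI
  rw [CompleteLattice.isCompactElement_iff_le_of_directed_sSup_le]
  intro A hA hd hle
  have hmem (p : Σ H, X H) : ∃ I : A, p.2.1 ∈ I.1.level p.1 := by
    obtain ⟨I, hI, h⟩ := (mem_sSup_of_directedOn hA hd).1 (span_le_iff.1 hle p.1 p.2.2)
    exact ⟨⟨I, hI⟩, h⟩
  choose f hf using hmem
  have (H : Subgroup G) : Finite (X H) := hX H
  have := hA.to_subtype
  obtain ⟨J, hJ⟩ := hd.directed_val.finite_le f
  exact ⟨J, J.2, span_le_iff.2 fun H x hx => hJ ⟨H, x, hx⟩ H (hf ⟨H, x, hx⟩)⟩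

/-- A supremum consists of sums of transfers from the levelwise union, so only products of elements
of `P`, `I` and `J` themselves need checking. -/
theorem sup_mul_sup_le {P I J : TambaraIdeal T} (h : I * J ≤ P) : (P ⊔ I) * (P ⊔ J) ≤ P := by
  rw [← sSup_pair, ← sSup_pair, sSup_eq_ofAbsorbing (Set.insert_nonempty _ _),
    sSup_eq_ofAbsorbing (Set.insert_nonempty _ _)]
  refine ofAbsorbing_mul_le _ _ ?_
  rintro H x ⟨_, rfl | rfl, hx⟩ y ⟨_, rfl | rfl, hy⟩
  · exact Ideal.mul_mem_right y _ hx
  · exact Ideal.mul_mem_right y _ hx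
  · exact Ideal.mul_mem_left _ x hy
  · exact mul_le_iff.1 h H x hx y hy

theorem isProper_iff_ne_top {I : TambaraIdeal T} : I.IsProper ↔ I ≠ ⊤ := by
  refine not_congr ⟨fun h => eq_top_iff.2 fun H x _ => ?_, fun h => ?_⟩
  · have := I.res_mem (le_top : H ≤ ⊤) h
    rw [map_one] at this
    rw [(Ideal.eq_top_iff_one _).2 this]
    trivial
  · rw [h]
    -- The lattice `⊤` is not given by full levels by definition, so it is compared with an ideal
    -- that visibly contains everything.
    have : ofAbsorbing (T := T) (fun _ => Set.univ) ⟨fun _ => trivial, fun _ _ _ => trivial,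
      fun _ _ _ => trivial, fun _ _ _ => trivial, fun _ _ _ _ _ _ => trivial⟩ ≤ ⊤ := le_top
    exact (ofAbsorbing_le_iff _).1 this ⊤ trivial

theorem fg_top : (⊤ : TambaraIdeal T).FG := by
  convert fg_span (T := T) (X := fun H => {1}) fun H => Set.finite_singleton 1
  refine (not_not.1 (isProper_iff_ne_top.not.1 ?_)).symm
  exact fun h => h (subset_span _ ⊤ rfl)

/-! ### Iterated squares and existence of primes. -/

/-- The iterated squares of a Tambara ideal. -/
def iterSq (I : TambaraIdeal T) : ℕ → TambaraIdeal T
  | 0 => I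
  | n + 1 => iterSq I n * iterSq I n

theorem FG.iterSq {I : TambaraIdeal T} (hI : I.FG) : ∀ n, (I.iterSq n).FG
  | 0 => hI
  | n + 1 => (hI.iterSq n).mul (hI.iterSq n)

theorem iterSq_antitone (I : TambaraIdeal T) : Antitone I.iterSq :=
  antitone_nat_of_succ_le fun _ => mul_le_left

theorem IsPrime.iterSq_le_iff {P I : TambaraIdeal T} (hP : P.IsPrime) {n : ℕ} :
    I.iterSq n ≤ P ↔ I ≤ P := by
  refine ⟨fun h => ?_, fun h => (I.iterSq_antitone n.zero_le).trans h⟩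
  induction n with
  | zero => exact h
  | succ n ih => exact ih ((hP.le_or_le _ _ h).elim id id)

/-- An ideal containing `J` and maximal among those containing no iterated square of `I` is prime.
Iterated squares replace powers, so associativity of the product is not needed. -/
theorem exists_isPrime_of_forall_not_iterSq_le {I J : TambaraIdeal T} (hI : I.FG)
    (hJ : ∀ n, ¬ I.iterSq n ≤ J) : ∃ P : TambaraIdeal T, P.IsPrime ∧ J ≤ P ∧ ¬ I ≤ P := by
  obtain ⟨P, hJP, hP⟩ := zorn_le_nonempty₀ {K : TambaraIdeal T | ∀ n, ¬ I.iterSq n ≤ K}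
    (fun c hc hchain K hK => ⟨sSup c, fun n hn => by
      -- By compactness, an iterated square below the supremum of the chain already lies below a
      -- member.
      obtain ⟨L, hL, hnL⟩ := (CompleteLattice.isCompactElement_iff_le_of_directed_sSup_le _ _).1
        (hI.iterSq n).isCompactElement c ⟨K, hK⟩ hchain.directedOn hn
      exact hc hL n hnL, fun _ => le_sSup⟩) J hJ
  have key {K : TambaraIdeal T} (hK : ¬ K ≤ P) : ∃ n, I.iterSq n ≤ P ⊔ K := by
    by_contra! h
    exact hK (le_sup_right.trans (hP.le_of_ge h le_sup_left))
  refine ⟨P, ⟨isProper_iff_ne_top.2 fun h => hP.prop 0 (h ▸ le_top), fun A B hAB => ?_⟩, hJP,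
    hP.prop 0⟩
  by_contra! h
  obtain ⟨m, hm⟩ := key h.1
  obtain ⟨n, hn⟩ := key h.2
  -- Both suprema contain the iterated square of index `max m n`; its square, of the next index,
  -- then lies in `P`.
  refine hP.prop (max m n + 1) ((mul_mono ?_ ?_).trans (sup_mul_sup_le hAB))
  · exact (I.iterSq_antitone (le_max_left _ _)).trans hm
  · exact (I.iterSq_antitone (le_max_right _ _)).trans hn

end TambaraIdeal

/-! ### The topology of the spectrum. -/

namespace NakaokaSpectrum

open TopologicalSpace TambaraIdeal

variable {T : TambaraFunctor.{u, v} G}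

/-- The set of all prime Tambara ideals that contain a given Tambara ideal. -/
def zeroLocus (I : TambaraIdeal T) : Set (NakaokaSpectrum T) := {P | I ≤ P.1}

theorem mem_zeroLocus {I : TambaraIdeal T} {P : NakaokaSpectrum T} :
    P ∈ zeroLocus I ↔ I ≤ P.1 := Iff.rfl

theorem zeroLocus_mul (I J : TambaraIdeal T) :
    zeroLocus (I * J) = zeroLocus I ∪ zeroLocus J :=
  Set.Subset.antisymm (fun P h => P.2.le_or_le I J h) <| by
    rintro P (h | h)
    exacts [mul_le_left.trans h, mul_le_right.trans h]

theorem zeroLocus_iSup {ι : Sort*} (I : ι → TambaraIdeal T) :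
    zeroLocus (⨆ i, I i) = ⋂ i, zeroLocus (I i) := by
  ext P
  simp [zeroLocus]

theorem zeroLocus_top : zeroLocus (⊤ : TambaraIdeal T) = ∅ :=
  Set.eq_empty_of_forall_notMem fun P h => isProper_iff_ne_top.1 P.2.proper (top_le_iff.1 h)

/-- The principal Tambara ideal generated by an element of `T(G/H)`. -/
def principal {H : Subgroup G} (x : T.obj H) : TambaraIdeal T :=
  span fun K => {y | ∃ h : H = K, h ▸ x = y}

theorem principal_le_iff {H : Subgroup G} {x : T.obj H} {I : TambaraIdeal T} :
    principal x ≤ I ↔ x ∈ I.level H := by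
  refine span_le_iff.trans ⟨fun h => h H ⟨rfl, rfl⟩, ?_⟩
  rintro h _ _ ⟨rfl, rfl⟩
  exact h

theorem fg_principal {H : Subgroup G} (x : T.obj H) : (principal x).FG :=
  fg_span fun _ => Set.Subsingleton.finite <| by
    rintro _ ⟨rfl, rfl⟩ _ ⟨_, rfl⟩
    rfl

theorem zeroLocus_principal {H : Subgroup G} (x : T.obj H) :
    zeroLocus (principal x) = vanishing T x :=
  Set.ext fun _ => principal_le_iff

theorem zeroLocus_eq_iInter (I : TambaraIdeal T) :
    zeroLocus I = ⋂ (H : Subgroup G) (x : I.level H), vanishing T (x : T.obj H) := by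
  ext P
  simp only [Set.mem_iInter, Subtype.forall]
  rfl

theorem isClosed_vanishing {H : Subgroup G} (x : T.obj H) : IsClosed (vanishing T x) :=
  ⟨isOpen_generateFrom_of_mem ⟨H, x, rfl⟩⟩

theorem isClosed_zeroLocus (I : TambaraIdeal T) : IsClosed (zeroLocus I) := by
  rw [zeroLocus_eq_iInter]
  exact isClosed_iInter fun _ => isClosed_iInter fun x => isClosed_vanishing x.1

variable (T) in
-- A finite intersection of subbasic open sets is the complement of the zero locus of a product of
-- principal ideals, finitely generated by `FG.mul`.
theorem isTopologicalBasis_compl_zeroLocus :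
    IsTopologicalBasis (Set.range fun I : {I : TambaraIdeal T // I.FG} => (zeroLocus I.1)ᶜ) := by
  refine (isTopologicalBasis_of_subbasis rfl).of_isOpen_of_subset ?_ ?_
  · rintro _ ⟨I, rfl⟩
    exact (isClosed_zeroLocus _).isOpen_compl
  · rintro _ ⟨s, ⟨hs, hsub⟩, rfl⟩
    dsimp only
    induction s, hs using Set.Finite.induction_on with
    | empty => exact ⟨⟨⊤, fg_top⟩, by simp [zeroLocus_top]⟩
    | @insert U s _ _ ih =>
      obtain ⟨H, x, rfl⟩ := hsub (Set.mem_insert _ _)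
      obtain ⟨I, hI⟩ := ih ((Set.subset_insert _ _).trans hsub)
      refine ⟨⟨principal x * I.1, (fg_principal x).mul I.2⟩, ?_⟩
      dsimp only at hI ⊢
      rw [zeroLocus_mul, Set.compl_union, Set.sInter_insert, hI, zeroLocus_principal]

theorem exists_eq_zeroLocus {Z : Set (NakaokaSpectrum T)} (hZ : IsClosed Z) :
    ∃ I : TambaraIdeal T, Z = zeroLocus I := by
  obtain ⟨β, f, hf, hr⟩ := (isTopologicalBasis_compl_zeroLocus T).open_eq_iUnion hZ.isOpen_compl
  choose I hI using hr
  refine ⟨⨆ i, (I i).1, ?_⟩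
  rw [zeroLocus_iSup, ← compl_inj_iff, hf, Set.compl_iInter]
  exact Set.iUnion_congr fun i => (hI i).symm

theorem exists_iterSq_le_of_zeroLocus_subset {I J : TambaraIdeal T} (hI : I.FG)
    (h : zeroLocus J ⊆ zeroLocus I) : ∃ n, I.iterSq n ≤ J := by
  by_contra! hn
  obtain ⟨P, hP, hJP, hIP⟩ := exists_isPrime_of_forall_not_iterSq_le hI hn
  exact hIP (h (a := ⟨P, hP⟩) hJP)

/-- A cover by complements of `zeroLocus (J i)` puts an iterated square of `I` below `⨆ i, J i`.
That square is a compact element, hence lies below a finite supremum, and a prime contains it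
exactly when it contains `I`. -/
theorem isCompact_compl_zeroLocus {I : TambaraIdeal T} (hI : I.FG) :
    IsCompact (zeroLocus I)ᶜ := by
  refine isCompact_of_finite_subcover fun {ι} U hU hIU => ?_
  choose J hJ using fun i => exists_eq_zeroLocus (hU i).isClosed_compl
  have hJ' (i : ι) : U i = (zeroLocus (J i))ᶜ := by rw [← hJ, compl_compl]
  simp only [hJ', ← Set.compl_iInter, Set.compl_subset_compl, ← zeroLocus_iSup] at hIU ⊢
  obtain ⟨n, hn⟩ := exists_iterSq_le_of_zeroLocus_subset hI hIU
  obtain ⟨t, ht⟩ := 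
    CompleteLattice.IsCompactElement.exists_finset_of_le_iSup _ (hI.iterSq n).isCompactElement J hn
  exact ⟨t, fun P hP => P.2.iterSq_le_iff.1 (ht.trans hP)⟩

instance : CompactSpace (NakaokaSpectrum T) :=
  ⟨by simpa [zeroLocus_top] using isCompact_compl_zeroLocus (T := T) fg_top⟩

instance : PrespectralSpace (NakaokaSpectrum T) :=
  .of_isTopologicalBasis' (isTopologicalBasis_compl_zeroLocus T)
    fun I => isCompact_compl_zeroLocus I.2

instance : QuasiSeparatedSpace (NakaokaSpectrum T) :=
  .of_isTopologicalBasis (isTopologicalBasis_compl_zeroLocus T) fun I J => by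
    rw [← Set.compl_union, ← zeroLocus_mul]
    exact isCompact_compl_zeroLocus (I.2.mul J.2)

theorem closure_singleton (P : NakaokaSpectrum T) : closure {P} = zeroLocus P.1 := by
  refine Set.Subset.antisymm
    (closure_minimal (Set.singleton_subset_iff.2 (le_refl P.1)) (isClosed_zeroLocus _)) ?_
  obtain ⟨I, hI⟩ := exists_eq_zeroLocus (isClosed_closure (s := {P}))
  rw [hI]
  have hP : P ∈ zeroLocus I := hI ▸ subset_closure rfl
  exact fun Q hQ => mem_zeroLocus.2 ((mem_zeroLocus.1 hP).trans hQ)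

instance : T0Space (NakaokaSpectrum T) := by
  refine ⟨fun P Q h => ?_⟩
  rw [inseparable_iff_closure_eq, closure_singleton, closure_singleton] at h
  exact Subtype.ext (le_antisymm (h.superset (le_refl Q.1)) (h.subset (le_refl P.1)))

instance : QuasiSober (NakaokaSpectrum T) where
  sober {Z} hZ hZc := by
    have hle {I : TambaraIdeal T} : I ≤ sInf {J | ∃ P ∈ Z, P.1 = J} ↔ Z ⊆ zeroLocus I := by
      rw [le_sInf_iff]
      exact ⟨fun h P hP => h P.1 ⟨P, hP, rfl⟩, fun h _ ⟨P, hP, e⟩ => e ▸ h hP⟩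
    generalize sInf {J | ∃ P ∈ Z, P.1 = J} = Q at hle
    -- By `hle`, primality of `Q` translates into irreducibility of `Z`.
    have hQ : Q.IsPrime := by
      refine ⟨isProper_iff_ne_top.2 fun h => ?_, fun I J hIJ => ?_⟩
      · obtain ⟨P, hP⟩ := hZ.nonempty
        exact (zeroLocus_top (T := T)).subset (hle.1 h.ge hP)
      · rw [hle, zeroLocus_mul] at hIJ
        rw [hle, hle]
        exact isPreirreducible_iff_isClosed_union_isClosed.1 hZ.isPreirreducible _ _
          (isClosed_zeroLocus I) (isClosed_zeroLocus J) hIJ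
    let q : NakaokaSpectrum T := ⟨Q, hQ⟩
    refine ⟨q, ?_⟩
    rw [isGenericPoint_def, closure_singleton]
    obtain ⟨I, rfl⟩ := exists_eq_zeroLocus hZc
    exact Set.Subset.antisymm (fun P hP => le_trans (hle.2 le_rfl) hP) (hle.1 le_rfl)

end NakaokaSpectrum

end Tambara

theorem mainTheorem5 {G : Type u} [Group G] [Finite G]
    (T : Tambara.TambaraFunctor.{u, v} G) :
    SpectralSpace (Tambara.NakaokaSpectrum T) where
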